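/- For a function $f\in L^1([0,1])$ with complex values, let $$\mathcal{E}f(\xi)=\int_0^1 e^{-i(\xi_1 x+\xi_2 x^2)}f(x)\,dx,\qquad \xi=(\xi_1,\xi_2)\in\mathbb{R}^2,$$ be its Fourier extension from the parabola. Then for every real number $q$ with $4<q<\infty$ there is a constant $C_q<\infty$, depending only on $q$, such that for every $f\in L^q([0,1])$ the function $\mathcal{E}f$ belongs to $L^q(\mathbb{R}^2)$ and $$\|\mathcal{E}f\|_{L^q(\mathbb{R}^2)}\le C_q\,\|f\|_{L^q([0,1])}.$$ -/

import Mathlib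

open MeasureTheory
open scoped NNReal ENNReal

/-- The Fourier extension operator of the parabola `x ↦ (x, x ^ 2)`, `0 ≤ x ≤ 1`:
`ℰ f (ξ) = ∫_0^1 exp (-i (ξ₁ x + ξ₂ x²)) f x dx`, for `ξ` in the Euclidean plane. Only the values
of `f` on `[0, 1]` enter. -/
noncomputable def parabolaExtension (f : ℝ → ℂ) (ξ : EuclideanSpace ℝ (Fin 2)) : ℂ :=
  ∫ x in Set.Icc (0 : ℝ) 1,
    Complex.exp (-Complex.I * ((ξ 0 * x + ξ 1 * x ^ 2 : ℝ) : ℂ)) * f x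

/-! Squaring makes the problem linear: `ℰ f ^ 2` is the Fourier transform of the image of `f ⊗ f`
under `(x, y) ↦ (x + y, x² + y²)`. On `x < y` this map is injective with Jacobian `2 (y - x)`, so
the image measure has density `2 F`, where `F = f x * f y / (2 (y - x))`; the 2 comes from the
symmetric half (`parabolaExtension_sq`). With `p = q / 2 > 2` and conjugate `r = q / (q - 2)`,
Hausdorff–Young bounds the `L^p` norm of the transform of `F` by the `L^r` norm of `F`. Changing
variables back, `∫ |F| ^ r` is a convolution form in `|f| ^ r` with kernel `(2u) ^ (1 - r)`,
integrable at 0 exactly when `r < 2`, that is `q > 4`. A Schur bound leaves `∫ |f| ^ (2r)`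
(`lintegral_parabolaDensity_rpow_le`), and `2r ≤ q` lets Hölder on the unit interval finish.
Hausdorff–Young, with a non-sharp constant, comes from Plancherel and the `L¹ → L^∞` bound by real
interpolation. -/

section FourierL2

/-! ### Plancherel on `L¹ ∩ L²`. -/

open SchwartzMap FourierTransform
open scoped ContDiff

variable {E : Type*} [NormedAddCommGroup E] [InnerProductSpace ℝ E] [FiniteDimensional ℝ E]
  [MeasurableSpace E] [BorelSpace E]

/-- The Fourier integral of an integrable function is continuous. -/
theorem continuous_fourier_of_integrable {f : E → ℂ} (hf : Integrable f) :
    Continuous (𝓕 f) :=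
  VectorFourier.fourierIntegral_continuous Real.continuous_fourierChar
    (by exact continuous_inner) hf

/-- On `L¹ ∩ L²` the Fourier integral agrees with the `L²` Fourier transform. -/
theorem fourier_toLp_ae_eq {f : E → ℂ} (hf : Integrable f) (hf2 : MemLp f 2) :
    (𝓕 (hf2.toLp f) : Lp (α := E) ℂ 2) =ᵐ[volume] 𝓕 f := by
  -- Test against smooth compactly supported `g`: on either side the transform can be moved onto
  -- `g`.
  refine ae_eq_of_integral_contDiff_smul_eq
    ((Lp.memLp _).locallyIntegrable (by norm_num))
    (continuous_fourier_of_integrable hf).locallyIntegrable fun g hg hgs => ?_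
  have hgc : HasCompactSupport (fun x => (g x : ℂ)) := hgs.comp_left Complex.ofReal_zero
  let φ : 𝓢(E, ℂ) := hgc.toSchwartzMap (Complex.ofRealCLM.contDiff.comp hg)
  have hφ : ∀ x, φ x = (g x : ℂ) := fun x => rfl
  have key := DFunLike.congr_fun (Lp.fourier_toTemperedDistribution_eq (hf2.toLp f)) φ
  rw [TemperedDistribution.fourier_apply, Lp.toTemperedDistribution_apply,
    Lp.toTemperedDistribution_apply] at key
  have h1 : ∫ x, (𝓕 φ : 𝓢(E, ℂ)) x • hf2.toLp f x = ∫ x, (𝓕 φ : 𝓢(E, ℂ)) x • f x :=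
    integral_congr_ae (by filter_upwards [hf2.coeFn_toLp] with x hx; rw [hx])
  have h2 : ∫ x, (𝓕 φ : 𝓢(E, ℂ)) x • f x = ∫ x, φ x • 𝓕 f x := by
    have := VectorFourier.integral_fourierIntegral_smul_eq_flip (L := innerₗ E)
      (f := φ) (g := f) (μ := volume) (ν := volume) Real.continuous_fourierChar
      (by exact continuous_inner) φ.integrable hf
    rw [flip_innerₗ] at this
    exact this
  calc ∫ x, g x • (𝓕 (hf2.toLp f) : Lp (α := E) ℂ 2 volume) x
      = ∫ x, φ x • (𝓕 (hf2.toLp f) : Lp (α := E) ℂ 2 volume) x := by simp [hφ]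
    _ = ∫ x, φ x • 𝓕 f x := by rw [← key, h1, h2]
    _ = _ := by simp [hφ]

/-- Plancherel's identity on `L¹ ∩ L²`. -/
theorem eLpNorm_fourier_eq {f : E → ℂ} (hf : Integrable f) (hf2 : MemLp f 2) :
    eLpNorm (𝓕 f) 2 volume = eLpNorm f 2 volume := by
  rw [← eLpNorm_congr_ae (fourier_toLp_ae_eq hf hf2), ← eLpNorm_congr_ae hf2.coeFn_toLp,
    ← Lp.enorm_def, ← Lp.enorm_def, ← ofReal_norm, ← ofReal_norm, Lp.norm_fourier_eq]

/-- Plancherel's identity on `L¹ ∩ L²`, as an equality of lower integrals. -/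
theorem lintegral_enorm_fourier_sq {f : E → ℂ} (hf : Integrable f) (hf2 : MemLp f 2) :
    ∫⁻ w, ‖𝓕 f w‖ₑ ^ (2 : ℝ) = ∫⁻ x, ‖f x‖ₑ ^ (2 : ℝ) := by
  have h := eLpNorm_fourier_eq hf hf2
  rw [eLpNorm_eq_lintegral_rpow_enorm_toReal (by norm_num) (by norm_num),
    eLpNorm_eq_lintegral_rpow_enorm_toReal (by norm_num) (by norm_num)] at h
  exact ENNReal.rpow_left_injective (by norm_num) h

/-- The Fourier integral is bounded by the `L¹` norm. -/
theorem enorm_fourier_le (f : E → ℂ) (w : E) : ‖𝓕 f w‖ₑ ≤ ∫⁻ x, ‖f x‖ₑ := by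
  rw [Real.fourier_eq]
  refine (enorm_integral_le_lintegral_enorm _).trans_eq ?_
  congr with x
  rw [Circle.smul_def, enorm_smul, ← ofReal_norm, Circle.norm_coe, ENNReal.ofReal_one, one_mul]

end FourierL2

/-! ### Hausdorff–Young by real interpolation. -/

section HausdorffYoung

open FourierTransform

variable {E : Type*} [NormedAddCommGroup E] [InnerProductSpace ℝ E] [FiniteDimensional ℝ E]
  [MeasurableSpace E] [BorelSpace E]

theorem fourier_add_of_integrable {f g : E → ℂ} (hf : Integrable f) (hg : Integrable g) (w : E) :
    𝓕 (fun x => f x + g x) w = 𝓕 f w + 𝓕 g w := by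
  simp only [Real.fourier_eq, smul_add]
  exact integral_add ((Real.fourierIntegral_convergent_iff w).2 hf)
    ((Real.fourierIntegral_convergent_iff w).2 hg)

/-- A bounded integrable function is square integrable. -/
theorem MeasureTheory.Integrable.memLp_two_of_norm_le {α : Type*} [MeasurableSpace α]
    {μ : Measure α} {f : α → ℂ} (hf : Integrable f μ) {s : ℝ} (hs : ∀ x, ‖f x‖ ≤ s) :
    MemLp f 2 μ := by
  rw [memLp_two_iff_integrable_sq_norm hf.aestronglyMeasurable]
  refine (hf.norm.const_mul s).mono' (hf.norm.aestronglyMeasurable.pow 2) (ae_of_all _ fun x => ?_)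
  rw [Real.norm_of_nonneg (sq_nonneg _), sq]
  exact mul_le_mul_of_nonneg_right (hs x) (norm_nonneg _)

/-- Weak-type bound for the Fourier integral of a function truncated at a height `s`. -/
theorem meas_lt_norm_fourier_le {f : E → ℂ} (hfm : Measurable f) (hf : Integrable f)
    {s t : ℝ} (ht : 0 < t)
    (hbig : ∫⁻ x, {x | s < ‖f x‖}.indicator (fun x => ‖f x‖ₑ) x ≤ ENNReal.ofReal (t / 2)) :
    volume {w | t < ‖𝓕 f w‖} ≤ ENNReal.ofReal (4 / t ^ 2) *
      ∫⁻ x, {x | ‖f x‖ ≤ s}.indicator (fun x => ENNReal.ofReal (‖f x‖ ^ 2)) x := by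
  have hm1 : MeasurableSet {x | ‖f x‖ ≤ s} := measurableSet_le hfm.norm measurable_const
  have hm2 : MeasurableSet {x | s < ‖f x‖} := measurableSet_lt measurable_const hfm.norm
  set g := {x | ‖f x‖ ≤ s}.indicator f with hg
  set h := {x | s < ‖f x‖}.indicator f with hh
  have hgi : Integrable g := hf.indicator hm1
  have hhi : Integrable h := hf.indicator hm2
  have hfgh : f = fun x => g x + h x := by
    ext x
    by_cases hx : ‖f x‖ ≤ s
    · simp [hg, hh, hx, not_lt.2 hx]
    · simp [hg, hh, hx, not_le.1 hx]
  -- The tall part uses up at most half of `t`; the other half must come from the truncated part,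
  -- handled by Plancherel and Chebyshev.
  have hh_le : ∀ w, ‖𝓕 h w‖ ≤ t / 2 := by
    intro w
    have h1 := enorm_fourier_le h w
    have h2 : ∫⁻ x, ‖h x‖ₑ ≤ ENNReal.ofReal (t / 2) := by
      refine le_trans (le_of_eq ?_) hbig
      congr with x
      rw [hh, enorm_indicator_eq_indicator_enorm]
    have h3 := h1.trans h2
    rw [← ofReal_norm] at h3
    exact (ENNReal.ofReal_le_ofReal_iff (by positivity)).1 h3
  have hg2 : MemLp g 2 := hgi.memLp_two_of_norm_le (s := max s 0) fun x => by
    by_cases hx : ‖f x‖ ≤ s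
    · simp [hg, hx]
    · simp [hg, hx]
  have hsub : {w | t < ‖𝓕 f w‖} ⊆ {w | ENNReal.ofReal ((t / 2) ^ 2) ≤ ‖𝓕 g w‖ₑ ^ (2 : ℝ)} := by
    intro w hw
    have hw' : t < ‖𝓕 f w‖ := hw
    have h1 : 𝓕 f w = 𝓕 g w + 𝓕 h w := by
      conv_lhs => rw [hfgh]
      exact fourier_add_of_integrable hgi hhi w
    have h2 := norm_add_le (𝓕 g w) (𝓕 h w)
    rw [← h1] at h2
    have h3 : t / 2 ≤ ‖𝓕 g w‖ := by linarith [hh_le w]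
    rw [Set.mem_ofPred_eq, ENNReal.rpow_two, ← ofReal_norm, ← ENNReal.ofReal_pow (norm_nonneg _)]
    exact ENNReal.ofReal_le_ofReal (pow_le_pow_left₀ (by positivity) h3 2)
  have hcheb := mul_meas_ge_le_lintegral₀ (μ := volume) (f := fun w => ‖𝓕 g w‖ₑ ^ (2 : ℝ))
    (((continuous_fourier_of_integrable hgi).measurable.enorm.pow_const _).aemeasurable)
    (ENNReal.ofReal ((t / 2) ^ 2))
  rw [lintegral_enorm_fourier_sq hgi hg2] at hcheb
  have hgint : ∫⁻ x, ‖g x‖ₑ ^ (2 : ℝ) =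
      ∫⁻ x, {x | ‖f x‖ ≤ s}.indicator (fun x => ENNReal.ofReal (‖f x‖ ^ 2)) x := by
    congr with x
    by_cases hx : ‖f x‖ ≤ s
    · simp only [hg, Set.indicator, Set.mem_ofPred_eq, hx, if_true]
      rw [ENNReal.rpow_two, ← ofReal_norm, ← ENNReal.ofReal_pow (norm_nonneg _)]
    · simp [hg, hx]
  rw [hgint] at hcheb
  have hc : ENNReal.ofReal (4 / t ^ 2) * ENNReal.ofReal ((t / 2) ^ 2) = 1 := by
    rw [← ENNReal.ofReal_mul (by positivity), ← ENNReal.ofReal_one]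
    congr 1
    field_simp
    norm_num
  calc volume {w | t < ‖𝓕 f w‖} ≤ _ := measure_mono hsub
    _ = ENNReal.ofReal (4 / t ^ 2) * (ENNReal.ofReal ((t / 2) ^ 2) *
        volume {w | ENNReal.ofReal ((t / 2) ^ 2) ≤ ‖𝓕 g w‖ₑ ^ (2 : ℝ)}) := by
      rw [← mul_assoc, hc, one_mul]
    _ ≤ _ := by gcongr

/-- The mass of a function above a height is controlled by its `r`-th moment. -/
theorem lintegral_indicator_lt_norm_le {α : Type*} [MeasurableSpace α] {μ : Measure α}
    {f : α → ℂ} {r s A : ℝ} (hr : 1 < r) (hs : 0 < s)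
    (hA : ∫⁻ x, ‖f x‖ₑ ^ r ∂μ ≤ ENNReal.ofReal A) :
    ∫⁻ x, {x | s < ‖f x‖}.indicator (fun x => ‖f x‖ₑ) x ∂μ ≤
      ENNReal.ofReal (s ^ (1 - r) * A) := by
  rw [ENNReal.ofReal_mul (by positivity)]
  refine le_trans ?_ (mul_le_mul_right hA _)
  rw [← lintegral_const_mul' _ _ ENNReal.ofReal_ne_top]
  refine lintegral_mono fun x => ?_
  by_cases hx : s < ‖f x‖
  · have h0 : 0 < ‖f x‖ := hs.trans hx
    simp only [Set.indicator, Set.mem_ofPred_eq, hx, if_true]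
    rw [← ofReal_norm, ENNReal.ofReal_rpow_of_pos h0, ← ENNReal.ofReal_mul (by positivity)]
    refine ENNReal.ofReal_le_ofReal ?_
    calc ‖f x‖ = ‖f x‖ ^ (1 - r) * ‖f x‖ ^ r := by
          rw [← Real.rpow_add h0]; simp
      _ ≤ _ := mul_le_mul_of_nonneg_right
          (Real.rpow_le_rpow_of_nonpos hs hx.le (by linarith)) (by positivity)
  · simp [hx]

theorem lintegral_Ioc_rpow {e T : ℝ} (he : -1 < e) (hT : 0 ≤ T) :
    ∫⁻ t in Set.Ioc 0 T, ENNReal.ofReal (t ^ e) = ENNReal.ofReal (T ^ (e + 1) / (e + 1)) := by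
  rw [← ofReal_integral_eq_lintegral_ofReal
    ((intervalIntegrable_iff_integrableOn_Ioc_of_le hT).1
      (intervalIntegral.intervalIntegrable_rpow' he))
    ((ae_restrict_iff' measurableSet_Ioc).2 (ae_of_all _ fun t ht => Real.rpow_nonneg ht.1.le _)),
    ← intervalIntegral.integral_of_le hT, integral_rpow (Or.inl he),
    Real.zero_rpow (by linarith), sub_zero]

/-- The Hausdorff–Young inequality for a positive bound `A` of the `r`-th moment, by
Marcinkiewicz interpolation between `L¹ → L^∞` and `L² → L²`. -/
theorem lintegral_fourier_rpow_le_of_pos {r p A : ℝ} (hr1 : 1 < r) (hr2 : r < 2)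
    (hp : p = r / (r - 1)) {f : E → ℂ} (hfm : Measurable f) (hf : Integrable f) (hA0 : 0 < A)
    (hA : ∫⁻ x, ‖f x‖ₑ ^ r ≤ ENNReal.ofReal A) :
    ∫⁻ w, ‖𝓕 f w‖ₑ ^ p ≤ ENNReal.ofReal (p * (4 / (p - 2) * 2 ^ (p - 2)) * A ^ (p - 1)) := by
  have hr0 : 0 < r - 1 := by linarith
  have hp2 : 2 < p := by rw [hp, lt_div_iff₀ hr0]; linarith
  have hexp : (1 - r) * (p - 2) = r - 2 := by rw [hp]; field_simp; ring
  -- The truncation height solves `s ^ (1 - r) * A = t / 2`, so the mass above it is at most `t /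
  -- 2`.
  set s : ℝ → ℝ := fun t => (2 * A / t) ^ (1 / (r - 1)) with hs
  have hsm : Measurable s := by fun_prop
  have hs_pos : ∀ t, 0 < t → 0 < s t := fun t ht => by positivity
  have hs_pow : ∀ t, 0 < t → s t ^ (1 - r) * A = t / 2 := by
    intro t ht
    rw [hs]
    dsimp only
    rw [← Real.rpow_mul (by positivity), show 1 / (r - 1) * (1 - r) = -1 by field_simp; ring,
      Real.rpow_neg_one]
    field_simp
  -- Inverting `s`: for fixed `x`, only a bounded range of levels `t` contributes after Tonelli.
  have hs_le : ∀ t a : ℝ, 0 < t → 0 < a → a ≤ s t → t ≤ 2 * A * a ^ (1 - r) := by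
    intro t a ht ha h
    have h1 := Real.rpow_le_rpow_of_nonpos ha h (show 1 - r ≤ 0 by linarith)
    have h2 := hs_pow t ht
    nlinarith
  -- The weight is `4 / t ^ 2` from the weak-type bound times `t ^ (p - 1)` from the layer-cake
  -- formula.
  set K : ℝ → E → ℝ≥0∞ := fun t x =>
    {q : ℝ × E | ‖f q.2‖ ≤ s q.1}.indicator
      (fun q => ENNReal.ofReal (4 * q.1 ^ (p - 3) * ‖f q.2‖ ^ 2)) (t, x) with hK
  have hKm : Measurable (Function.uncurry K) := by
    refine Measurable.indicator ?_ (measurableSet_le (by fun_prop) (by fun_prop))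
    fun_prop
  have hlayer := lintegral_rpow_eq_lintegral_meas_lt_mul (μ := volume) (f := fun w => ‖𝓕 f w‖)
    (ae_of_all _ fun w => norm_nonneg _)
    (continuous_fourier_of_integrable hf).norm.measurable.aemeasurable
    (show 0 < p by linarith)
  have hlhs : ∫⁻ w, ‖𝓕 f w‖ₑ ^ p = ∫⁻ w, ENNReal.ofReal (‖𝓕 f w‖ ^ p) := by
    congr with w
    rw [← ofReal_norm, ENNReal.ofReal_rpow_of_nonneg (norm_nonneg _) (by linarith)]
  have h1 : ∫⁻ t in Set.Ioi (0 : ℝ), volume {w | t < ‖𝓕 f w‖} * ENNReal.ofReal (t ^ (p - 1)) ≤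
      ∫⁻ t in Set.Ioi (0 : ℝ), ∫⁻ x, K t x := by
    refine setLIntegral_mono' measurableSet_Ioi fun t ht => ?_
    have ht : 0 < t := ht
    have hw := meas_lt_norm_fourier_le hfm hf (s := s t) ht
      ((lintegral_indicator_lt_norm_le hr1 (hs_pos t ht) hA).trans_eq (by rw [hs_pow t ht]))
    refine (mul_le_mul_left hw _).trans (le_of_eq ?_)
    rw [mul_right_comm, ← ENNReal.ofReal_mul (by positivity),
      ← lintegral_const_mul' _ _ ENNReal.ofReal_ne_top]
    congr with x
    by_cases hx : ‖f x‖ ≤ s t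
    · simp only [hK, Set.indicator, Set.mem_ofPred_eq, hx, if_true]
      rw [← ENNReal.ofReal_mul (by positivity)]
      congr 2
      rw [show p - 3 = p - 1 - 2 by ring, Real.rpow_sub ht (p - 1) 2, Real.rpow_two]
      ring
    · simp [hK, hx]
  have h2 : ∀ x, ∫⁻ t in Set.Ioi (0 : ℝ), K t x ≤
      ENNReal.ofReal (4 / (p - 2) * (2 * A) ^ (p - 2)) * ‖f x‖ₑ ^ r := by
    intro x
    rcases (norm_nonneg (f x)).eq_or_lt with h0 | h0
    · refine le_trans (le_of_eq ?_) zero_le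
      simp [hK, Set.indicator, ← h0]
    set T := 2 * A * ‖f x‖ ^ (1 - r) with hT
    have hT0 : 0 < T := by positivity
    calc ∫⁻ t in Set.Ioi (0 : ℝ), K t x
        ≤ ∫⁻ t in Set.Ioi (0 : ℝ), (Set.Ioc 0 T).indicator
            (fun t => ENNReal.ofReal (4 * ‖f x‖ ^ 2) * ENNReal.ofReal (t ^ (p - 3))) t := by
          refine setLIntegral_mono' measurableSet_Ioi fun t ht => ?_
          have ht : 0 < t := ht
          by_cases hx : ‖f x‖ ≤ s t
          · have : t ∈ Set.Ioc 0 T := ⟨ht, hs_le t _ ht h0 hx⟩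
            rw [Set.indicator_of_mem this]
            simp only [hK, Set.indicator, Set.mem_ofPred_eq, hx, if_true]
            rw [← ENNReal.ofReal_mul (by positivity)]
            refine ENNReal.ofReal_le_ofReal (le_of_eq (by ring))
          · simp [hK, hx]
      _ ≤ ∫⁻ t, (Set.Ioc 0 T).indicator
            (fun t => ENNReal.ofReal (4 * ‖f x‖ ^ 2) * ENNReal.ofReal (t ^ (p - 3))) t :=
          setLIntegral_le_lintegral _ _
      _ = ENNReal.ofReal (4 * ‖f x‖ ^ 2 * (T ^ (p - 2) / (p - 2))) := by
          rw [lintegral_indicator measurableSet_Ioc,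
            lintegral_const_mul' _ _ ENNReal.ofReal_ne_top,
            lintegral_Ioc_rpow (by linarith) hT0.le, ← ENNReal.ofReal_mul (by positivity),
            show p - 3 + 1 = p - 2 by ring]
      _ = _ := by
          rw [← ofReal_norm, ENNReal.ofReal_rpow_of_pos h0, ← ENNReal.ofReal_mul (by
            have : 0 < p - 2 := by linarith
            positivity), hT, Real.mul_rpow (by positivity) (by positivity),
            ← Real.rpow_mul h0.le, hexp, Real.rpow_sub h0, Real.rpow_two]
          congr 1
          field_simp
  rw [hlhs, hlayer]
  calc _ ≤ ENNReal.ofReal p * ∫⁻ t in Set.Ioi (0 : ℝ), ∫⁻ x, K t x := by gcongr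
    _ = ENNReal.ofReal p * ∫⁻ x, ∫⁻ t in Set.Ioi (0 : ℝ), K t x := by
      rw [lintegral_lintegral_swap hKm.aemeasurable]
    _ ≤ ENNReal.ofReal p * ∫⁻ x, ENNReal.ofReal (4 / (p - 2) * (2 * A) ^ (p - 2)) * ‖f x‖ₑ ^ r := by
      gcongr with x
      exact h2 x
    _ ≤ ENNReal.ofReal p * (ENNReal.ofReal (4 / (p - 2) * (2 * A) ^ (p - 2)) *
        ENNReal.ofReal A) := by
      rw [lintegral_const_mul' _ _ ENNReal.ofReal_ne_top]
      gcongr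
    _ = _ := by
      have : 0 < p - 2 := by linarith
      rw [← ENNReal.ofReal_mul (by positivity), ← ENNReal.ofReal_mul (by linarith)]
      congr 1
      rw [show p - 1 = p - 2 + 1 by ring, Real.rpow_add hA0, Real.rpow_one,
        Real.mul_rpow (by norm_num) hA0.le]
      ring

/-- The **Hausdorff–Young inequality** for `1 < r < 2` and the conjugate exponent
`p = r / (r - 1)`, with an unspecified constant. -/
theorem exists_lintegral_fourier_rpow_le {r p : ℝ} (hr1 : 1 < r) (hr2 : r < 2)
    (hp : p = r / (r - 1)) : ∃ C : ℝ≥0, ∀ f : E → ℂ, Measurable f → Integrable f →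
      ∫⁻ x, ‖f x‖ₑ ^ r ≠ ∞ →
        ∫⁻ w, ‖𝓕 f w‖ₑ ^ p ≤ C * (∫⁻ x, ‖f x‖ₑ ^ r) ^ (p - 1) := by
  have hr0 : 0 < r - 1 := by linarith
  have hp2 : 2 < p := by rw [hp, lt_div_iff₀ hr0]; linarith
  refine ⟨(p * (4 / (p - 2) * 2 ^ (p - 2))).toNNReal, fun f hfm hf hfin => ?_⟩
  -- The truncation height degenerates for `A = 0`; then `f` vanishes almost everywhere.
  rcases eq_or_ne (∫⁻ x, ‖f x‖ₑ ^ r) 0 with h0 | h0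
  · have hf0 : f =ᵐ[volume] fun _ => 0 := by
      rw [lintegral_eq_zero_iff (hfm.enorm.pow_const _)] at h0
      filter_upwards [h0] with x hx
      simpa [show 0 < r by linarith, show ¬ r < 0 by linarith] using hx
    have : ∀ w, 𝓕 f w = 0 := fun w => by
      rw [Real.fourier_congr_ae hf0 w]
      simp [Real.fourier_eq]
    simp [this, show 0 < p by linarith]
  · have hpos := ENNReal.toReal_pos h0 hfin
    refine (lintegral_fourier_rpow_le_of_pos hr1 hr2 hp hfm hf hpos
      (ENNReal.ofReal_toReal hfin).ge).trans (le_of_eq ?_)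
    have : 0 < p - 2 := by linarith
    rw [ENNReal.ofReal_mul (by positivity), ← ENNReal.ofReal_rpow_of_pos hpos,
      ENNReal.ofReal_toReal hfin]
    rfl

end HausdorffYoung

/-! ### The sum map of the parabola as a change of variables. -/

section ChangeOfVariables

/-- The identification of `ℝ × ℝ` with the Euclidean plane. -/
noncomputable def planeEquiv : ℝ × ℝ ≃ᵐ EuclideanSpace ℝ (Fin 2) :=
  MeasurableEquiv.finTwoArrow.symm.trans (MeasurableEquiv.toLp 2 (Fin 2 → ℝ))

theorem planeEquiv_apply_zero (p : ℝ × ℝ) : planeEquiv p 0 = p.1 := rfl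

theorem planeEquiv_apply_one (p : ℝ × ℝ) : planeEquiv p 1 = p.2 := rfl

theorem measurePreserving_planeEquiv : MeasurePreserving planeEquiv :=
  (PiLp.volume_preserving_toLp (Fin 2)).comp (volume_preserving_finTwoArrow ℝ).symm

/-- The sum of the points of the parabola with abscissae `p.1` and `p.2`. -/
def parabolaSum (p : ℝ × ℝ) : ℝ × ℝ := (p.1 + p.2, p.1 ^ 2 + p.2 ^ 2)

/-- The open half-plane above the diagonal. -/
def upperHalf : Set (ℝ × ℝ) := {p | p.1 < p.2}

theorem measurableSet_upperHalf : MeasurableSet upperHalf :=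
  measurableSet_lt measurable_fst measurable_snd

/-- The derivative of `parabolaSum`. -/
noncomputable def fderivParabolaSum (p : ℝ × ℝ) : ℝ × ℝ →L[ℝ] ℝ × ℝ :=
  (Matrix.toLin (.finTwoProd ℝ) (.finTwoProd ℝ)
    !![1, 1; 2 * p.1, 2 * p.2]).toContinuousLinearMap

theorem hasFDerivAt_parabolaSum (p : ℝ × ℝ) :
    HasFDerivAt parabolaSum (fderivParabolaSum p) p := by
  unfold fderivParabolaSum
  rw [Matrix.toLin_finTwoProd_toContinuousLinearMap]
  have h1 : HasFDerivAt (fun q : ℝ × ℝ => q.1) (ContinuousLinearMap.fst ℝ ℝ ℝ) p := hasFDerivAt_fst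
  have h2 : HasFDerivAt (fun q : ℝ × ℝ => q.2) (ContinuousLinearMap.snd ℝ ℝ ℝ) p := hasFDerivAt_snd
  convert! HasFDerivAt.prodMk (𝕜 := ℝ) (h1.add h2) ((h1.pow 2).add (h2.pow 2)) using 2 <;> simp

theorem det_fderivParabolaSum (p : ℝ × ℝ) : (fderivParabolaSum p).det = 2 * (p.2 - p.1) := by
  unfold fderivParabolaSum
  simp only [LinearMap.det_toContinuousLinearMap, LinearMap.det_toLin, Matrix.det_fin_two_of]
  ring

/-- `parabolaSum p` determines the distance between the coordinates of `p`. -/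
theorem sqrt_parabolaSum {p : ℝ × ℝ} (hp : p ∈ upperHalf) :
    √(2 * (parabolaSum p).2 - (parabolaSum p).1 ^ 2) = p.2 - p.1 := by
  have hp' : p.1 < p.2 := hp
  have : 2 * (parabolaSum p).2 - (parabolaSum p).1 ^ 2 = (p.2 - p.1) ^ 2 := by
    simp only [parabolaSum]; ring
  rw [this, Real.sqrt_sq (by linarith)]

/-- The image gives the sum of the coordinates and, by `sqrt_parabolaSum`, their difference. -/
theorem injOn_parabolaSum : Set.InjOn parabolaSum upperHalf := by
  intro p hp p' hp' h
  have h1 := sqrt_parabolaSum hp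
  rw [h, sqrt_parabolaSum hp'] at h1
  have h2 : p.1 + p.2 = p'.1 + p'.2 := congrArg Prod.fst h
  ext <;> linarith

/-- The condition is positivity of the discriminant of the quadratic with roots `p.1` and `p.2`; the
preimage is the quadratic formula. -/
theorem image_parabolaSum : parabolaSum '' upperHalf = {w | 0 < 2 * w.2 - w.1 ^ 2} := by
  ext w
  constructor
  · rintro ⟨p, hp, rfl⟩
    have hp' : p.1 < p.2 := hp
    have : 2 * (parabolaSum p).2 - (parabolaSum p).1 ^ 2 = (p.2 - p.1) ^ 2 := by
      simp only [parabolaSum]; ring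
    simp only [Set.mem_ofPred_eq, this]
    exact pow_pos (by linarith) 2
  · intro hw
    have hw' : 0 < 2 * w.2 - w.1 ^ 2 := hw
    have hs := Real.sq_sqrt hw'.le
    have hs' := Real.sqrt_pos.2 hw'
    refine ⟨((w.1 - √(2 * w.2 - w.1 ^ 2)) / 2, (w.1 + √(2 * w.2 - w.1 ^ 2)) / 2), ?_, ?_⟩
    · change (_ : ℝ) < _
      dsimp only
      linarith
    · ext
      · simp only [parabolaSum]; ring
      · simp only [parabolaSum]
        linear_combination hs / 2

theorem abs_det_fderivParabolaSum {p : ℝ × ℝ} (hp : p ∈ upperHalf) :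
    |(fderivParabolaSum p).det| = 2 * (p.2 - p.1) := by
  have hp' : p.1 < p.2 := hp
  rw [det_fderivParabolaSum, abs_of_pos (by linarith)]

/-- Change of variables `w = (x + y, x² + y²)`, for lower integrals. -/
theorem lintegral_eq_lintegral_parabolaSum {g : EuclideanSpace ℝ (Fin 2) → ℝ≥0∞}
    (hg : ∀ w, ¬ 0 < 2 * w 1 - w 0 ^ 2 → g w = 0) :
    ∫⁻ w, g w = ∫⁻ p in upperHalf,
      ENNReal.ofReal (2 * (p.2 - p.1)) * g (planeEquiv (parabolaSum p)) := by
  have hm : MeasurableSet (parabolaSum '' upperHalf) := by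
    rw [image_parabolaSum]
    exact measurableSet_lt measurable_const (by fun_prop)
  have hi : (fun p => g (planeEquiv p)) =
      (parabolaSum '' upperHalf).indicator fun p => g (planeEquiv p) := by
    refine (Set.indicator_eq_self.2 fun w hw => ?_).symm
    rw [image_parabolaSum]
    by_contra h
    exact hw (hg _ h)
  rw [← measurePreserving_planeEquiv.lintegral_comp_emb planeEquiv.measurableEmbedding, hi,
    lintegral_indicator hm,
    lintegral_image_eq_lintegral_abs_det_fderiv_mul volume measurableSet_upperHalf
      (fun p _ => (hasFDerivAt_parabolaSum p).hasFDerivWithinAt) injOn_parabolaSum]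
  exact setLIntegral_congr_fun measurableSet_upperHalf fun p hp => by
    simp only [abs_det_fderivParabolaSum hp]

/-- Change of variables `w = (x + y, x² + y²)`, for Bochner integrals. -/
theorem integral_eq_integral_parabolaSum {g : EuclideanSpace ℝ (Fin 2) → ℂ}
    (hg : ∀ w, ¬ 0 < 2 * w 1 - w 0 ^ 2 → g w = 0) :
    ∫ w, g w = ∫ p in upperHalf, (2 * (p.2 - p.1)) • g (planeEquiv (parabolaSum p)) := by
  rw [← measurePreserving_planeEquiv.integral_comp planeEquiv.measurableEmbedding,
    ← setIntegral_eq_integral_of_forall_compl_eq_zero (s := parabolaSum '' upperHalf),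
    integral_image_eq_integral_abs_det_fderiv_smul volume measurableSet_upperHalf
      (fun p _ => (hasFDerivAt_parabolaSum p).hasFDerivWithinAt) injOn_parabolaSum]
  · exact setIntegral_congr_fun measurableSet_upperHalf fun p hp => by
      simp only [abs_det_fderivParabolaSum hp]
  · rw [image_parabolaSum]
    intro w hw
    exact hg _ hw

end ChangeOfVariables

/-! ### Symmetric double integrals on the line. -/

section BilinearKernel

/-- A Schur-type bound for a positive bilinear convolution form on the line. -/
theorem lintegral_convolution_form_le {k φ : ℝ → ℝ≥0∞} (hk : Measurable k) (hφ : Measurable φ) :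
    ∫⁻ p : ℝ × ℝ, k (p.2 - p.1) * (φ p.1 * φ p.2) ≤ 2 * (∫⁻ u, k u) * ∫⁻ x, φ x ^ 2 := by
  have hpt : ∀ a b : ℝ≥0∞, a * b ≤ a ^ 2 + b ^ 2 := by
    intro a b
    rcases le_total a b with h | h
    · exact (mul_le_mul_left h b).trans (by rw [sq b]; exact le_add_self)
    · exact (mul_le_mul_right h a).trans (by rw [sq a]; exact le_self_add)
  have h1 : ∫⁻ p : ℝ × ℝ, k (p.2 - p.1) * φ p.1 ^ 2 = (∫⁻ u, k u) * ∫⁻ x, φ x ^ 2 := by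
    rw [Measure.volume_eq_prod, lintegral_prod _ (by fun_prop)]
    have : ∀ x, ∫⁻ y, k (y - x) * φ x ^ 2 = (∫⁻ u, k u) * φ x ^ 2 := fun x => by
      rw [lintegral_mul_const _ (by fun_prop), lintegral_sub_right_eq_self k x]
    simp only [this]
    rw [lintegral_const_mul _ (by fun_prop)]
  have h2 : ∫⁻ p : ℝ × ℝ, k (p.2 - p.1) * φ p.2 ^ 2 = (∫⁻ u, k u) * ∫⁻ x, φ x ^ 2 := by
    rw [Measure.volume_eq_prod, lintegral_prod_symm _ (by fun_prop)]
    have : ∀ y, ∫⁻ x, k (y - x) * φ y ^ 2 = (∫⁻ u, k u) * φ y ^ 2 := fun y => by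
      rw [lintegral_mul_const _ (by fun_prop), lintegral_sub_left_eq_self k y]
    simp only [this]
    rw [lintegral_const_mul _ (by fun_prop)]
  calc _ ≤ ∫⁻ p : ℝ × ℝ, (k (p.2 - p.1) * φ p.1 ^ 2 + k (p.2 - p.1) * φ p.2 ^ 2) := by
        refine lintegral_mono fun p => ?_
        rw [← mul_add]
        exact mul_le_mul_right (hpt _ _) _
    _ = _ := by
      rw [lintegral_add_left (by fun_prop), h1, h2]
      ring

/-- The square of an integral as twice an integral over the half-plane above the diagonal. -/
theorem integral_sq_eq_two_mul_setIntegral_upperHalf {h : ℝ → ℂ} (hh : Integrable h) :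
    (∫ x, h x) ^ 2 = 2 * ∫ p in upperHalf, h p.1 * h p.2 := by
  have hG : Integrable (fun p : ℝ × ℝ => h p.1 * h p.2) := hh.mul_prod hh
  have hswap : MeasurePreserving (Prod.swap : ℝ × ℝ → ℝ × ℝ) := Measure.measurePreserving_swap
  have hdiag : volume {p : ℝ × ℝ | p.1 = p.2} = 0 := by
    rw [Measure.volume_eq_prod,
      Measure.measure_prod_null (measurableSet_eq_fun measurable_fst measurable_snd)]
    refine ae_of_all _ fun x => ?_
    have : Prod.mk x ⁻¹' {p : ℝ × ℝ | p.1 = p.2} = {x} := by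
      ext y
      simp [eq_comm]
    simp [this]
  -- The two sets differ by the diagonal, which is null.
  have hae : (upperHalfᶜ : Set (ℝ × ℝ)) =ᵐ[volume] Prod.swap ⁻¹' upperHalf := by
    have : ∀ᵐ p : ℝ × ℝ, p.1 ≠ p.2 := by
      rw [ae_iff]
      simpa using hdiag
    filter_upwards [this] with p hp
    refine propext ?_
    change ¬ p.1 < p.2 ↔ p.2 < p.1
    exact ⟨fun h => lt_of_le_of_ne (not_lt.1 h) hp.symm, fun h => not_lt.2 h.le⟩
  have hcompl : ∫ p in upperHalfᶜ, h p.1 * h p.2 = ∫ p in upperHalf, h p.1 * h p.2 := by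
    rw [setIntegral_congr_set hae, ← hswap.setIntegral_preimage_emb
      MeasurableEquiv.prodComm.measurableEmbedding _ upperHalf]
    simp only [Prod.fst_swap, Prod.snd_swap, mul_comm]
  rw [sq, ← integral_prod_mul, ← Measure.volume_eq_prod,
    ← integral_add_compl measurableSet_upperHalf hG, hcompl, two_mul]

end BilinearKernel

theorem norm_exp_neg_I_mul_ofReal (a : ℝ) : ‖Complex.exp (-Complex.I * (a : ℂ))‖ = 1 := by
  rw [neg_mul_comm, mul_comm, ← Complex.ofReal_neg, Complex.norm_exp_ofReal_mul_I]

/-! ### The density behind the squared extension. -/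

section ParabolaDensity

open FourierTransform

/-- The density of the self-convolution of `f` on the parabola, up to a factor `2`: its value at
`(x + y, x² + y²)` with `x < y` is `f x * f y / (2 * (y - x))`. -/
noncomputable def parabolaDensity (f : ℝ → ℂ) (w : EuclideanSpace ℝ (Fin 2)) : ℂ :=
  {w : EuclideanSpace ℝ (Fin 2) | 0 < 2 * w 1 - w 0 ^ 2}.indicator
    (fun w => f ((w 0 - √(2 * w 1 - w 0 ^ 2)) / 2) * f ((w 0 + √(2 * w 1 - w 0 ^ 2)) / 2) *
      ((2 * √(2 * w 1 - w 0 ^ 2) : ℝ) : ℂ)⁻¹) w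

theorem parabolaDensity_eq_zero (f : ℝ → ℂ) (w : EuclideanSpace ℝ (Fin 2))
    (hw : ¬ 0 < 2 * w 1 - w 0 ^ 2) : parabolaDensity f w = 0 := by
  rw [parabolaDensity, Set.indicator_of_notMem (by exact hw)]

theorem parabolaDensity_parabolaSum (f : ℝ → ℂ) {p : ℝ × ℝ} (hp : p ∈ upperHalf) :
    parabolaDensity f (planeEquiv (parabolaSum p)) =
      f p.1 * f p.2 * ((2 * (p.2 - p.1) : ℝ) : ℂ)⁻¹ := by
  have hmem : 0 < 2 * (parabolaSum p).2 - (parabolaSum p).1 ^ 2 := by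
    have : parabolaSum p ∈ parabolaSum '' upperHalf := ⟨p, hp, rfl⟩
    rwa [image_parabolaSum] at this
  rw [parabolaDensity, Set.indicator_of_mem (by exact hmem)]
  simp only [planeEquiv_apply_zero, planeEquiv_apply_one, sqrt_parabolaSum hp]
  congr 3 <;> simp only [parabolaSum] <;> ring_nf

theorem measurable_parabolaDensity {f : ℝ → ℂ} (hf : Measurable f) :
    Measurable (parabolaDensity f) := by
  refine Measurable.indicator ?_ (measurableSet_lt measurable_const (by fun_prop))
  fun_prop

/-- The `r`-th moment of `parabolaDensity f` is bounded by the `2 r`-th moment of `f`. -/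
theorem lintegral_parabolaDensity_rpow_le {r : ℝ} (hr1 : 1 ≤ r) (hr2 : r < 2) {f : ℝ → ℂ}
    (hf : Measurable f) (hf0 : ∀ x, x ∉ Set.Icc (0 : ℝ) 1 → f x = 0) :
    ∫⁻ w, ‖parabolaDensity f w‖ₑ ^ r ≤
      ENNReal.ofReal (2 / (2 - r)) * ∫⁻ x, ‖f x‖ₑ ^ (2 * r) := by
  -- Cutting at 1 loses nothing, since both points lie in `[0, 1]`; `r < 2` makes the kernel
  -- integrable.
  set k : ℝ → ℝ≥0∞ := (Set.Ioc (0 : ℝ) 1).indicator fun u => ENNReal.ofReal (u ^ (1 - r)) with hk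
  have hkm : Measurable k := Measurable.indicator (by fun_prop) measurableSet_Ioc
  have hr0 : 0 < r := by linarith
  have hkint : ∫⁻ u, k u = ENNReal.ofReal (1 / (2 - r)) := by
    rw [hk, lintegral_indicator measurableSet_Ioc, lintegral_Ioc_rpow (by linarith) zero_le_one,
      Real.one_rpow, show 1 - r + 1 = 2 - r by ring]
  rw [lintegral_eq_lintegral_parabolaSum fun w hw => by
    rw [parabolaDensity_eq_zero f w hw, enorm_zero, ENNReal.zero_rpow_of_pos hr0]]
  calc _ ≤ ∫⁻ p in upperHalf, k (p.2 - p.1) * (‖f p.1‖ₑ ^ r * ‖f p.2‖ₑ ^ r) := by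
        refine setLIntegral_mono' measurableSet_upperHalf fun p hp => ?_
        rw [parabolaDensity_parabolaSum f hp]
        have hp' : 0 < p.2 - p.1 := sub_pos.2 hp
        by_cases h1 : p.1 ∈ Set.Icc (0 : ℝ) 1
        swap
        · simp [hf0 _ h1, hr0]
        by_cases h2 : p.2 ∈ Set.Icc (0 : ℝ) 1
        swap
        · simp [hf0 _ h2, hr0]
        have hu : p.2 - p.1 ∈ Set.Ioc (0 : ℝ) 1 := ⟨hp', by linarith [h1.1, h2.2]⟩
        rw [hk, Set.indicator_of_mem hu, enorm_mul, enorm_mul, ENNReal.mul_rpow_of_nonneg _ _ hr0.le,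
          ENNReal.mul_rpow_of_nonneg _ _ hr0.le, mul_comm (_ * _) (_ ^ r), ← mul_assoc]
        refine mul_le_mul_left ?_ _
        rw [← ofReal_norm, norm_inv, Complex.norm_real, Real.norm_of_nonneg (by positivity),
          ENNReal.ofReal_rpow_of_nonneg (by positivity) hr0.le, ← ENNReal.ofReal_mul (by positivity)]
        refine ENNReal.ofReal_le_ofReal ?_
        have h3 : 0 < 2 * (p.2 - p.1) := by positivity
        -- One factor is the Jacobian, the power `-r` is the density; the 2 can be dropped because
        -- `1 - r ≤ 0`.
        calc 2 * (p.2 - p.1) * (2 * (p.2 - p.1))⁻¹ ^ r = (2 * (p.2 - p.1)) ^ (1 - r) := by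
              rw [Real.inv_rpow h3.le, Real.rpow_sub h3, Real.rpow_one]
              rfl
          _ ≤ _ := Real.rpow_le_rpow_of_nonpos hp' (by linarith) (by linarith)
    _ ≤ ∫⁻ p : ℝ × ℝ, k (p.2 - p.1) * (‖f p.1‖ₑ ^ r * ‖f p.2‖ₑ ^ r) :=
        setLIntegral_le_lintegral _ _
    _ ≤ _ := lintegral_convolution_form_le (φ := fun x => ‖f x‖ₑ ^ r) hkm (by fun_prop)
    _ = _ := by
      rw [hkint, ← ENNReal.ofReal_ofNat, ← ENNReal.ofReal_mul (by norm_num), mul_one_div]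
      congr 2
      ext x
      rw [← ENNReal.rpow_two, ← ENNReal.rpow_mul, mul_comm r]

/-- The square of the extension of `f` is a rescaled Fourier transform of `parabolaDensity f`. -/
theorem parabolaExtension_sq {f : ℝ → ℂ} (hf : Integrable f)
    (hf0 : ∀ x, x ∉ Set.Icc (0 : ℝ) 1 → f x = 0) (ξ : EuclideanSpace ℝ (Fin 2)) :
    parabolaExtension f ξ ^ 2 = 2 * 𝓕 (parabolaDensity f) ((2 * Real.pi)⁻¹ • ξ) := by
  set e : ℝ → ℂ := fun x => Complex.exp (-Complex.I * ((ξ 0 * x + ξ 1 * x ^ 2 : ℝ) : ℂ)) with he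
  have hec : Continuous e := by fun_prop
  have henorm : ∀ x, ‖e x‖ = 1 := fun x => norm_exp_neg_I_mul_ofReal _
  have hh : Integrable fun x => e x * f x :=
    hf.bdd_mul hec.aestronglyMeasurable (ae_of_all _ fun x => (henorm x).le)
  have hE : parabolaExtension f ξ = ∫ x, e x * f x :=
    setIntegral_eq_integral_of_forall_compl_eq_zero fun x hx => by simp [hf0 x hx]
  rw [hE, integral_sq_eq_two_mul_setIntegral_upperHalf hh, Real.fourier_eq',
    integral_eq_integral_parabolaSum fun w hw => by simp [parabolaDensity_eq_zero f w hw]]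
  congr 1
  refine setIntegral_congr_fun measurableSet_upperHalf fun p hp => ?_
  have hp' : 0 < p.2 - p.1 := sub_pos.2 hp
  have hne : ((2 * (p.2 - p.1) : ℝ) : ℂ) ≠ 0 := by
    rw [Complex.ofReal_ne_zero]; positivity
  -- Scaling by `(2π)⁻¹` cancels the `2π` in the normalisation of `𝓕`, and the phase splits over the
  -- two points.
  have hexp : Complex.exp (((-2 * Real.pi * inner ℝ (planeEquiv (parabolaSum p))
      ((2 * Real.pi)⁻¹ • ξ) : ℝ) : ℂ) * Complex.I) = e p.1 * e p.2 := by
    rw [he]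
    dsimp only
    rw [← Complex.exp_add, inner_smul_right, PiLp.inner_apply, Fin.sum_univ_two]
    simp only [planeEquiv_apply_zero, planeEquiv_apply_one, parabolaSum, RCLike.inner_apply,
      conj_trivial]
    congr 1
    have : -2 * Real.pi * ((2 * Real.pi)⁻¹ * (ξ 0 * (p.1 + p.2) + ξ 1 * (p.1 ^ 2 + p.2 ^ 2))) =
        -(ξ 0 * (p.1 + p.2) + ξ 1 * (p.1 ^ 2 + p.2 ^ 2)) := by
      field_simp
    rw [this]
    push_cast
    ring
  rw [hexp, parabolaDensity_parabolaSum f hp, smul_eq_mul, Complex.real_smul]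
  field_simp

end ParabolaDensity

/-! ### The extension estimate. -/

theorem continuous_parabolaExtension {f : ℝ → ℂ}
    (hf : Integrable f (volume.restrict (Set.Icc (0 : ℝ) 1))) :
    Continuous (parabolaExtension f) := by
  refine continuous_of_dominated (bound := fun x => ‖f x‖) (fun ξ => ?_) (fun ξ => ?_) hf.norm ?_
  · exact (Continuous.aestronglyMeasurable (by fun_prop)).mul hf.aestronglyMeasurable
  · refine ae_of_all _ fun x => ?_
    rw [norm_mul, norm_exp_neg_I_mul_ofReal, one_mul]
  · exact ae_of_all _ fun x => by fun_prop

/-- Rescaling of a lower integral on the Euclidean plane. -/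
theorem lintegral_comp_smul_plane {g : EuclideanSpace ℝ (Fin 2) → ℝ≥0∞} (hg : Measurable g) {c : ℝ}
    (hc : c ≠ 0) : ∫⁻ ξ, g (c • ξ) = ENNReal.ofReal |(c ^ 2)⁻¹| * ∫⁻ ξ, g ξ := by
  rw [← lintegral_map hg (measurable_const_smul c), Measure.map_addHaar_smul _ hc,
    lintegral_smul_measure]
  simp

/-- On the unit interval, a lower moment is controlled by a higher one. -/
theorem lintegral_rpow_le_of_eq_zero_off_Icc {f : ℝ → ℂ} (hf : Measurable f)
    (hf0 : ∀ x, x ∉ Set.Icc (0 : ℝ) 1 → f x = 0) {s q : ℝ} (hs : 0 < s) (hsq : s ≤ q) :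
    ∫⁻ x, ‖f x‖ₑ ^ s ≤ (∫⁻ x, ‖f x‖ₑ ^ q) ^ (s / q) := by
  have hq : 0 < q := hs.trans_le hsq
  have hr : ∀ a : ℝ, 0 < a →
      ∫⁻ x, ‖f x‖ₑ ^ a = ∫⁻ x in Set.Icc (0 : ℝ) 1, ‖f x‖ₑ ^ a := fun a ha => by
    rw [← lintegral_indicator measurableSet_Icc]
    congr with x
    by_cases hx : x ∈ Set.Icc (0 : ℝ) 1
    · rw [Set.indicator_of_mem hx]
    · simp [Set.indicator_of_notMem hx, hf0 x hx, ha]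
  -- Total mass 1 makes `L^s` norms increase with `s`, without a constant.
  have : IsProbabilityMeasure (volume.restrict (Set.Icc (0 : ℝ) 1)) := ⟨by simp⟩
  have h := eLpNorm'_le_eLpNorm'_of_exponent_le (μ := volume.restrict (Set.Icc (0 : ℝ) 1))
    (f := f) hs hsq hf.aestronglyMeasurable
  rw [eLpNorm', eLpNorm', ← hr s hs, ← hr q hq] at h
  have h2 := ENNReal.rpow_le_rpow h hs.le
  rw [← ENNReal.rpow_mul, ← ENNReal.rpow_mul, one_div_mul_cancel hs.ne', ENNReal.rpow_one] at h2
  rwa [← one_div_mul_eq_div]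

/-- The extension estimate for measurable functions supported in the unit interval. -/
theorem exists_lintegral_parabolaExtension_rpow_le {q : ℝ} (hq : 4 < q) :
    ∃ C : ℝ≥0, ∀ f : ℝ → ℂ, Measurable f → (∀ x, x ∉ Set.Icc (0 : ℝ) 1 → f x = 0) →
      ∫⁻ x, ‖f x‖ₑ ^ q ≠ ∞ →
        ∫⁻ ξ, ‖parabolaExtension f ξ‖ₑ ^ q ≤ C * ∫⁻ x, ‖f x‖ₑ ^ q := by
  set r : ℝ := q / (q - 2) with hr
  set p : ℝ := q / 2 with hp
  have hq2 : 0 < q - 2 := by linarith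
  have hr1 : 1 < r := by rw [hr, lt_div_iff₀ hq2]; linarith
  have hr2 : r < 2 := by rw [hr, div_lt_iff₀ hq2]; linarith
  have hp2 : 2 < p := by rw [hp]; linarith
  have hpr : p = r / (r - 1) := by
    have : r - 1 = 2 / (q - 2) := by rw [hr]; field_simp; ring
    rw [this, hr, hp]
    field_simp
  have h2r : 2 * r ≤ q := by
    rw [hr, ← mul_div_assoc, div_le_iff₀ hq2]; nlinarith
  -- Homogeneity: the powers from Hölder and Hausdorff–Young compose to the first power of `∫ |f| ^
  -- q`.
  have hexp : 2 * r / q * (p - 1) = 1 := by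
    rw [hr, hp]; field_simp
  obtain ⟨C, hC⟩ := exists_lintegral_fourier_rpow_le (E := EuclideanSpace ℝ (Fin 2)) hr1 hr2 hpr
  -- The factors come from the 2 in `parabolaExtension_sq`, the dilation of the plane,
  -- Hausdorff–Young and the moment bound.
  refine ⟨(2 : ℝ≥0) ^ p * Real.toNNReal |(((2 * Real.pi)⁻¹) ^ 2)⁻¹| * C *
    Real.toNNReal (2 / (2 - r)) ^ (p - 1), fun f hf hf0 hfin => ?_⟩
  set N := ∫⁻ x, ‖f x‖ₑ ^ q with hN
  have hfin' : ∀ s : ℝ, 0 < s → s ≤ q → ∫⁻ x, ‖f x‖ₑ ^ s ≠ ∞ := fun s hs hsq =>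
    ((lintegral_rpow_le_of_eq_zero_off_Icc hf hf0 hs hsq).trans_lt
      (ENNReal.rpow_lt_top_of_nonneg (by positivity) hfin)).ne
  have hfi : Integrable f := ⟨hf.aestronglyMeasurable, by
    have := hfin' 1 one_pos (by linarith)
    simp only [ENNReal.rpow_one] at this
    exact this.lt_top⟩
  have hF := measurable_parabolaDensity hf
  have hFr : ∀ s : ℝ, 1 ≤ s → s < 2 → ∫⁻ w, ‖parabolaDensity f w‖ₑ ^ s ≠ ∞ := fun s hs1 hs2 =>
    ((lintegral_parabolaDensity_rpow_le hs1 hs2 hf hf0).trans_lt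
      (ENNReal.mul_lt_top ENNReal.ofReal_lt_top
        (hfin' (2 * s) (by linarith) (by linarith)).lt_top)).ne
  have hFi : Integrable (parabolaDensity f) := ⟨hF.aestronglyMeasurable, by
    have := hFr 1 le_rfl (by norm_num)
    simp only [ENNReal.rpow_one] at this
    exact this.lt_top⟩
  have hpt : ∀ ξ, ‖parabolaExtension f ξ‖ₑ ^ q =
      (2 : ℝ≥0∞) ^ p *
        ‖FourierTransform.fourier (parabolaDensity f) ((2 * Real.pi)⁻¹ • ξ)‖ₑ ^ p := by
    intro ξ
    have h2 : ‖(2 : ℂ)‖ₑ = 2 := by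
      rw [← ofReal_norm]; simp
    have hsq := congrArg (‖·‖ₑ) (parabolaExtension_sq hfi hf0 ξ)
    simp only [enorm_mul, enorm_pow, h2] at hsq
    rw [← ENNReal.mul_rpow_of_nonneg _ _ (by linarith), ← hsq, ← ENNReal.rpow_two,
      ← ENNReal.rpow_mul, hp, mul_div_cancel₀ q two_ne_zero]
  calc ∫⁻ ξ, ‖parabolaExtension f ξ‖ₑ ^ q
      = (2 : ℝ≥0∞) ^ p * (ENNReal.ofReal |(((2 * Real.pi)⁻¹) ^ 2)⁻¹| *
          ∫⁻ η, ‖FourierTransform.fourier (parabolaDensity f) η‖ₑ ^ p) := by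
        simp only [hpt]
        have hm : Measurable fun η => ‖FourierTransform.fourier (parabolaDensity f) η‖ₑ ^ p :=
          (continuous_fourier_of_integrable hFi).measurable.enorm.pow_const _
        rw [← lintegral_comp_smul_plane hm (by positivity)]
        exact lintegral_const_mul _ (hm.comp (measurable_const_smul _))
    _ ≤ (2 : ℝ≥0∞) ^ p * (ENNReal.ofReal |(((2 * Real.pi)⁻¹) ^ 2)⁻¹| *
          (C * (ENNReal.ofReal (2 / (2 - r)) * N ^ (2 * r / q)) ^ (p - 1))) := by
        gcongr
        refine (hC _ hF hFi (hFr r hr1.le hr2)).trans ?_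
        refine mul_le_mul_right (ENNReal.rpow_le_rpow ?_ (by linarith)) _
        refine (lintegral_parabolaDensity_rpow_le hr1.le hr2 hf hf0).trans ?_
        gcongr
        exact lintegral_rpow_le_of_eq_zero_off_Icc hf hf0 (by linarith) h2r
    _ = _ := by
        have hp1 : 0 ≤ p - 1 := by linarith
        rw [ENNReal.mul_rpow_of_nonneg _ _ hp1, ← ENNReal.rpow_mul, hexp, ENNReal.rpow_one]
        push_cast
        rw [ENNReal.coe_rpow_of_nonneg _ (by linarith : 0 ≤ p),
          ENNReal.coe_rpow_of_nonneg _ hp1]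
        simp only [ENNReal.ofReal, ENNReal.coe_ofNat]
        ring

theorem mainTheorem1 (q : ℝ) (hq : 4 < q) :
    ∃ C : ℝ≥0, ∀ f : ℝ → ℂ,
      MemLp f (ENNReal.ofReal q) (volume.restrict (Set.Icc (0 : ℝ) 1)) →
        MemLp (parabolaExtension f) (ENNReal.ofReal q)
            (volume : Measure (EuclideanSpace ℝ (Fin 2))) ∧
          eLpNorm (parabolaExtension f) (ENNReal.ofReal q)
              (volume : Measure (EuclideanSpace ℝ (Fin 2))) ≤
            (C : ℝ≥0∞) *
              eLpNorm f (ENNReal.ofReal q) (volume.restrict (Set.Icc (0 : ℝ) 1)) := by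
  obtain ⟨C, hC⟩ := exists_lintegral_parabolaExtension_rpow_le hq
  have hq0 : 0 < q := by linarith
  refine ⟨C ^ (1 / q), fun f hf => ?_⟩
  have hq1 : (1 : ℝ≥0∞) ≤ ENNReal.ofReal q := by
    rw [← ENNReal.ofReal_one]; exact ENNReal.ofReal_le_ofReal (by linarith)
  have hne : ENNReal.ofReal q ≠ 0 := by simpa using hq0
  have hnorm : ∀ {α : Type} [MeasurableSpace α] (μ : Measure α) (g : α → ℂ),
      eLpNorm g (ENNReal.ofReal q) μ = (∫⁻ x, ‖g x‖ₑ ^ q ∂μ) ^ (1 / q) := fun μ g => by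
    rw [eLpNorm_eq_lintegral_rpow_enorm_toReal hne ENNReal.ofReal_ne_top,
      ENNReal.toReal_ofReal hq0.le]
  -- A Borel representative extended by zero has the same extension, since only almost every value
  -- on `[0, 1]` matters.
  set g : ℝ → ℂ := (Set.Icc (0 : ℝ) 1).indicator (hf.1.mk f) with hg
  have hgm : Measurable g := hf.1.stronglyMeasurable_mk.measurable.indicator measurableSet_Icc
  have hg0 : ∀ x, x ∉ Set.Icc (0 : ℝ) 1 → g x = 0 := fun x hx => Set.indicator_of_notMem hx _
  have hfg : f =ᵐ[volume.restrict (Set.Icc (0 : ℝ) 1)] g :=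
    hf.1.ae_eq_mk.trans (indicator_ae_eq_restrict measurableSet_Icc).symm
  have hE : parabolaExtension f = parabolaExtension g := by
    ext ξ
    refine integral_congr_ae ?_
    filter_upwards [hfg] with x hx
    rw [hx]
  have hgint : ∫⁻ x, ‖g x‖ₑ ^ q = ∫⁻ x in Set.Icc (0 : ℝ) 1, ‖f x‖ₑ ^ q := by
    have h1 : ∫⁻ x in Set.Icc (0 : ℝ) 1, ‖f x‖ₑ ^ q = ∫⁻ x in Set.Icc (0 : ℝ) 1, ‖g x‖ₑ ^ q :=
      lintegral_congr_ae (by filter_upwards [hfg] with x hx; rw [hx])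
    rw [h1, ← lintegral_indicator measurableSet_Icc]
    congr with x
    by_cases hx : x ∈ Set.Icc (0 : ℝ) 1
    · rw [Set.indicator_of_mem hx]
    · simp [Set.indicator_of_notMem hx, hg0 x hx, hq0]
  have hfin : ∫⁻ x, ‖g x‖ₑ ^ q ≠ ∞ := by
    rw [hgint]
    intro htop
    have := hf.2
    rw [hnorm, htop, ENNReal.top_rpow_of_pos (by positivity)] at this
    exact lt_irrefl _ this
  have hle : eLpNorm (parabolaExtension f) (ENNReal.ofReal q) volume ≤
      ((C ^ (1 / q) : ℝ≥0) : ℝ≥0∞) *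
        eLpNorm f (ENNReal.ofReal q) (volume.restrict (Set.Icc (0 : ℝ) 1)) := by
    rw [hnorm, hnorm, ← hgint, hE, ENNReal.coe_rpow_of_nonneg _ (by positivity),
      ← ENNReal.mul_rpow_of_nonneg _ _ (by positivity)]
    exact ENNReal.rpow_le_rpow (hC g hgm hg0 hfin) (by positivity)
  exact ⟨⟨(continuous_parabolaExtension (hf.integrable hq1)).aestronglyMeasurable,
    hle.trans_lt (ENNReal.mul_lt_top ENNReal.coe_lt_top hf.2)⟩, hle⟩
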